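/- Let $(\mathcal A,\mathcal E)$ be an exact category in the sense of Quillen (an additive, locally small category with a class $\mathcal E$ of kernel–cokernel sequences $X\rightarrowtail Y\twoheadrightarrow Z$, called conflations, satisfying the exact axioms; the left and right maps of conflations are called inflations and deflations). Assume that $\mathcal A$ is weakly idempotent complete, i.e. every split monomorphism is an inflation. *Notation.* $\operatorname{Ext}^1(A,B)$ is the group of equivalence classes of conflations $B\rightarrowtail M\twoheadrightarrow A$. For a class $\mathcal S$ of objects, $\mathcal S^{\perp}=\{Y:\operatorname{Ext}^1(S,Y)=0\ \forall S\in\mathcal S\}$ and ${}^{\perp}\mathcal S=\{X:\operatorname{Ext}^1(X,S)=0\ \forall S\in\mathcal S\}$. For an ordinal $\lambda$, a $\lambda$-sequence of morphisms in a class $\mathcal D$ is a functor $X:\lambda\to\mathcal A$ with $X_\gamma=\operatorname{colim}_{\alpha<\gamma}X_\alpha$ for every limit ordinal $\gamma<\lambda$ and with $X_\alpha\to X_{\alpha+1}$ in $\mathcal D$ whenever $\alpha+1<\lambda$; if $\lambda>0$ and $\operatorname{colim}X$ exists, $X_0\to\operatorname{colim}_{\alpha<\lambda} X_\alpha$ is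 its transfinite composition. For a set $I$ of morphisms, $I$-cell (the class of relative $I$-cell complexes) is the class of transfinite compositions of pushouts of morphisms in $I$; $\operatorname{Cell}(I)$ is the class of objects $A$ with $(0\to A)\in I$-cell; $\operatorname{Cok}I$ is the class of objects isomorphic to the cokernel of some $i\in I$; $I$-inj is the class of morphisms having the right lifting property with respect to all $i\in I$. Let $I$ be a set of inflations such that: 1. $I$ is homological: if $A\to 0$ is in $I$-inj, then $A\in(\operatorname{Cok}I)^{\perp}$; 2. $I$ admits the small object argument: transfinite compositions of pushouts of morphisms in $I$ exist; set-indexed coproducts of morphisms in $I$ exist; and for the domain $A$ of each morphism in $I$ there is a cardinal $\kappa$ such that for every ordinal $\lambda$ with $\operatorname{cf}(\lambda)>\kappa$ and every $\lambda$-sequence $X$ of morphisms in $I$-cell, the map $\operatorname{colim}_{\alpha<\lambda}\operatorname{Hom}(A,X_\alpha)\to\operatorname{Hom}(A,\operatorname{colim}_{\alpha<\lambda}X_\alpha)$ is bijective; 3. every relative $I$-cell complex is an inflation; 4. $\operatorname{Cell}(I)$ is a class of generators: every object $A$ admits a deflation $\coprod_{s\in S}G_s\twoheadrightarrow A$ with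 $S$ a set and all $G_s\in\operatorname{Cell}(I)$. Then: (a) For every object $A$ there is a conflation $T\rightarrowtail B\twoheadrightarrow A$ with $T\in(\operatorname{Cok}I)^{\perp}$ and $B\in\operatorname{Cell}(I)$. (b) Put $\mathcal Y=(\operatorname{Cok}I)^{\perp}$ and $\mathcal X={}^{\perp}\mathcal Y$. Then $(\mathcal X,\mathcal Y)$ is a complete cotorsion pair: $\mathcal X={}^{\perp}\mathcal Y$, $\mathcal Y=\mathcal X^{\perp}$, and every object $A$ admits conflations $Y\rightarrowtail X\twoheadrightarrow A$ and $A\rightarrowtail Y'\twoheadrightarrow X'$ with $X,X'\in\mathcal X$ and $Y,Y'\in\mathcal Y$. Moreover, $\mathcal X$ consists precisely of the direct summands of objects of $\operatorname{Cell}(I)$. -/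

import Mathlib

open CategoryTheory CategoryTheory.Limits
open scoped ZeroObject

universe v u

namespace CategoryTheory

variable {C : Type u} [Category.{v} C]

section Additive

variable [Preadditive C]

/-- `f` is the left-hand morphism of a sequence in the class `P`. -/
def IsLeftMap (P : ObjectProperty (ShortComplex C)) : MorphismProperty C :=
  fun _ Y f => ∃ (Z : C) (g : Y ⟶ Z) (w : f ≫ g = 0), P (ShortComplex.mk f g w)

/-- `g` is the right-hand morphism of a sequence in the class `P`. -/
def IsRightMap (P : ObjectProperty (ShortComplex C)) : MorphismProperty C :=
  fun Y _ g => ∃ (X : C) (f : X ⟶ Y) (w : f ≫ g = 0), P (ShortComplex.mk f g w)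

variable (C) in
/-- A Quillen exact structure: a class of kernel-cokernel sequences (the conflations), closed
under isomorphism, such that identities are inflations and deflations, both classes are closed
under composition, pushouts of inflations along arbitrary morphisms exist and are inflations,
and pullbacks of deflations along arbitrary morphisms exist and are deflations. -/
structure ExactStructure where
  /-- The distinguished short exact sequences. -/
  conflation : ObjectProperty (ShortComplex C)
  conflation_of_iso : ∀ {S T : ShortComplex C}, (S ≅ T) → conflation S → conflation T
  isKernel : ∀ (S : ShortComplex C), conflation S →
    Nonempty (IsLimit (KernelFork.ofι S.f S.zero))
  isCokernel : ∀ (S : ShortComplex C), conflation S →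
    Nonempty (IsColimit (CokernelCofork.ofπ S.g S.zero))
  id_inflation : ∀ X : C, IsLeftMap conflation (𝟙 X)
  id_deflation : ∀ X : C, IsRightMap conflation (𝟙 X)
  comp_inflation : ∀ {X Y Z : C} (f : X ⟶ Y) (g : Y ⟶ Z),
    IsLeftMap conflation f → IsLeftMap conflation g → IsLeftMap conflation (f ≫ g)
  comp_deflation : ∀ {X Y Z : C} (f : X ⟶ Y) (g : Y ⟶ Z),
    IsRightMap conflation f → IsRightMap conflation g → IsRightMap conflation (f ≫ g)
  pushout_inflation : ∀ {X Y X' : C} (i : X ⟶ Y) (f : X ⟶ X'), IsLeftMap conflation i →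
    ∃ (Y' : C) (i' : X' ⟶ Y') (f' : Y ⟶ Y'), IsPushout f i i' f' ∧ IsLeftMap conflation i'
  pullback_deflation : ∀ {Y Z Z' : C} (p : Y ⟶ Z) (f : Z' ⟶ Z), IsRightMap conflation p →
    ∃ (Y' : C) (p' : Y' ⟶ Z') (f' : Y' ⟶ Y), IsPullback f' p' p f ∧ IsRightMap conflation p'

namespace ExactStructure

variable (E : ExactStructure C)

/-- The inflations of an exact structure. -/
def inflation : MorphismProperty C := IsLeftMap E.conflation

/-- The deflations of an exact structure. -/
def deflation : MorphismProperty C := IsRightMap E.conflation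

/-- Every split monomorphism is an inflation. -/
def IsWeaklyIdempotentComplete : Prop :=
  ∀ {X Y : C} (i : X ⟶ Y) (r : Y ⟶ X), i ≫ r = 𝟙 X → E.inflation i

/-- A conflation `B ↣ M ↠ A`. -/
structure Extension (A B : C) where
  /-- The middle term. -/
  M : C
  /-- The inflation. -/
  i : B ⟶ M
  /-- The deflation. -/
  p : M ⟶ A
  w : i ≫ p = 0
  conflation : E.conflation (ShortComplex.mk i p w)

/-- Two extensions of `A` by `B` are equivalent if their middle terms are isomorphic compatibly
with the morphisms from `B` and to `A`. -/
def extensionSetoid (A B : C) : Setoid (E.Extension A B) where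
  r S T := ∃ e : S.M ≅ T.M, S.i ≫ e.hom = T.i ∧ e.hom ≫ T.p = S.p
  iseqv :=
    { refl := fun S => ⟨Iso.refl _, by simp, by simp⟩
      symm := by
        rintro S T ⟨e, h₁, h₂⟩
        exact ⟨e.symm, by simp [← h₁], by simp [← h₂]⟩
      trans := by
        rintro S T U ⟨e, h₁, h₂⟩ ⟨e', h₁', h₂'⟩
        exact ⟨e ≪≫ e', by simp [← h₁', ← h₁], by simp [h₂', h₂]⟩ }

/-- The Yoneda `Ext¹(A, B)`: equivalence classes of conflations `B ↣ M ↠ A`. -/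
def YonedaExt (A B : C) : Type (max u v) := _root_.Quotient (E.extensionSetoid A B)

/-- `Ext¹(A, B) = 0`. The set `Ext¹(A, B)` contains the class of the split extension, which is the
zero of its group structure, so the group is trivial iff it has at most one element. -/
def ExtVanishes (A B : C) : Prop := Subsingleton (E.YonedaExt A B)

/-- The class of `Y` with `Ext¹(X, Y) = 0` for all `X` in `P`. -/
def rightPerp (P : ObjectProperty C) : ObjectProperty C :=
  fun Y => ∀ X : C, P X → E.ExtVanishes X Y

/-- The class of `X` with `Ext¹(X, Y) = 0` for all `Y` in `P`. -/
def leftPerp (P : ObjectProperty C) : ObjectProperty C :=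
  fun X => ∀ Y : C, P Y → E.ExtVanishes X Y

/-- `(P, Q)` is a cotorsion pair. -/
structure IsCotorsionPair (P Q : ObjectProperty C) : Prop where
  left_eq : P = E.leftPerp Q
  right_eq : Q = E.rightPerp P

/-- `(P, Q)` is a complete cotorsion pair: a cotorsion pair with enough projectives and
enough injectives. -/
structure IsCompleteCotorsionPair (P Q : ObjectProperty C) : Prop
    extends E.IsCotorsionPair P Q where
  enough_projectives : ∀ A : C, ∃ (Y X : C) (i : Y ⟶ X) (p : X ⟶ A) (w : i ≫ p = 0),
    E.conflation (ShortComplex.mk i p w) ∧ P X ∧ Q Y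
  enough_injectives : ∀ A : C, ∃ (Y X : C) (i : A ⟶ Y) (p : Y ⟶ X) (w : i ≫ p = 0),
    E.conflation (ShortComplex.mk i p w) ∧ P X ∧ Q Y

/-- `P` is a class of generators: every object is the target of a deflation from a (set-indexed)
coproduct of objects of `P`. -/
def IsGeneratingClass (P : ObjectProperty C) : Prop :=
  ∀ A : C, ∃ (S : Type v) (G : S → C) (c : Cofan G) (p : c.pt ⟶ A),
    (∀ s, P (G s)) ∧ Nonempty (IsColimit c) ∧ E.deflation p

end ExactStructure

/-- The class of objects that are a cokernel of some morphism in `I`. -/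
def cokernelClass (I : MorphismProperty C) : ObjectProperty C :=
  fun A => ∃ (X Y : C) (i : X ⟶ Y) (p : Y ⟶ A) (w : i ≫ p = 0),
    I i ∧ Nonempty (IsColimit (CokernelCofork.ofπ p w))

end Additive

section Cells

/-- A functor from a well-ordered type is a transfinite sequence of morphisms in `D` if it is
continuous at limit elements and its successor steps are in `D`. -/
structure IsTransfiniteSequence (D : MorphismProperty C) {J : Type v} [LinearOrder J]
    [SuccOrder J] [OrderBot J] [WellFoundedLT J] (F : J ⥤ C) : Prop where
  continuous : F.IsWellOrderContinuous
  map_mem : ∀ j : J, ¬ IsMax j → D (F.map (homOfLE (Order.le_succ j)))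

/-- The relative `I`-cell complexes: transfinite compositions of pushouts of morphisms in `I`. -/
def relativeCells (I : MorphismProperty C) : MorphismProperty C :=
  MorphismProperty.transfiniteCompositions.{v} I.pushouts

/-- The `I`-cell complexes: objects `A` such that `0 ⟶ A` is a relative `I`-cell complex. -/
def cellObjects [HasZeroMorphisms C] [HasZeroObject C] (I : MorphismProperty C) :
    ObjectProperty C :=
  fun A => relativeCells I (0 : (0 : C) ⟶ A)

/-- `A` is `κ`-small relative to `D`: `Hom(A, -)` preserves the colimits of all transfinite
sequences of morphisms in `D` whose length has cofinality greater than `κ`.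
(Sequences with a last term, for which the condition is automatic, are not excluded.) -/
def IsSmallRelativeTo (κ : Cardinal.{v}) (D : MorphismProperty C) (A : C) : Prop :=
  ∀ (J : Type v) [LinearOrder J] [SuccOrder J] [OrderBot J] [WellFoundedLT J] (F : J ⥤ C),
    κ < Order.cof J → IsTransfiniteSequence D F →
      PreservesColimit F (coyoneda.obj (Opposite.op A))

/-- The set `I` of morphisms admits the small object argument. -/
structure AdmitsSmallObjectArgument (I : MorphismProperty C) : Prop where
  /-- Transfinite compositions of pushouts of morphisms in `I` exist. -/
  hasColimit : ∀ (J : Type v) [LinearOrder J] [SuccOrder J] [OrderBot J] [WellFoundedLT J]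
    (F : J ⥤ C), IsTransfiniteSequence I.pushouts F → HasColimit F
  /-- Coproducts of set-indexed families of morphisms in `I` exist. -/
  hasCoproduct : ∀ (S : Type v) (X Y : S → C) (i : ∀ s, X s ⟶ Y s), (∀ s, I (i s)) →
    HasCoproduct X ∧ HasCoproduct Y
  /-- The domains of morphisms in `I` are small relative to the relative `I`-cell complexes. -/
  small_domain : ∀ {X Y : C} (i : X ⟶ Y), I i →
    ∃ κ : Cardinal.{v}, IsSmallRelativeTo κ (relativeCells I) X

end Cells

/-- A set `I` of inflations is homological if `A` lies in the right orthogonal of the cokernels of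
`I` whenever `A ⟶ 0` has the right lifting property with respect to `I`. -/
def ExactStructure.IsHomological [Preadditive C] [HasZeroObject C] (E : ExactStructure C)
    (I : MorphismProperty C) : Prop :=
  ∀ A : C, I.rlp (0 : A ⟶ (0 : C)) → E.rightPerp (cokernelClass I) A

/-- The class of direct summands of objects of `P`. -/
def directSummands [Preadditive C] [HasBinaryBiproducts C] (P : ObjectProperty C) :
    ObjectProperty C :=
  fun A => ∃ B A' : C, P B ∧ Nonempty (B ≅ A ⊞ A')

end CategoryTheory

namespace CategoryTheory

namespace ExactStructure

/-! ### Elementary calculus of conflations. -/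

section Conflations

variable {C : Type u} [Category.{v} C] [Preadditive C] (E : ExactStructure C)

/-! Everything follows from one factorization and one lifting lemma. The small object argument
(`AdmitsSmallObjectArgument.exists_factorization`) writes any morphism as a relative `I`-cell
complex followed by a map in `I`-inj. For `0 ⟶ A`, the second factor is a deflation because cell
complexes generate (`deflation_of_rlp`), and its kernel maps to `0` by a map in `I`-inj, hence lies
in (Cok I)^⊥ as `I` is homological. For `A ⟶ 0`, the first factor is an inflation by hypothesis and
the middle object lies in (Cok I)^⊥ for the same reason.

Membership in the left class rests on `hasLiftingProperty_of_extVanishes`: an inflation with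
cokernel S lifts against a deflation with kernel Y once Ext¹(S, Y) = 0. So deflations with kernel in
(Cok I)^⊥ are in `I`-inj, relative cell complexes lift against them, and such lifts split the
relevant extensions (`leftPerp_of_relativeCells`). For A in the left class the conflation of (a)
splits, which exhibits A as a summand of a cell complex.

The small object argument attaches one cell at a time along all ordinals. A bookkeeping function
makes every lifting problem of every stage get solved later, and the diagram is cut at a limit
ordinal of large cofinality before which all problems of earlier stages are solved. -/

variable {E} in
lemma mono_of_conflation {X Y Z : C} {f : X ⟶ Y} {g : Y ⟶ Z} {w : f ≫ g = 0}
    (h : E.conflation (ShortComplex.mk f g w)) : Mono f := by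
  obtain ⟨hl⟩ := E.isKernel _ h
  exact mono_of_isLimit_fork hl

variable {E} in
lemma epi_of_conflation {X Y Z : C} {f : X ⟶ Y} {g : Y ⟶ Z} {w : f ≫ g = 0}
    (h : E.conflation (ShortComplex.mk f g w)) : Epi g := by
  obtain ⟨hl⟩ := E.isCokernel _ h
  exact epi_of_isColimit_cofork hl

variable {E} in
lemma exists_lift_of_conflation {X Y Z : C} {f : X ⟶ Y} {g : Y ⟶ Z} {w : f ≫ g = 0}
    (h : E.conflation (ShortComplex.mk f g w)) {T : C} (t : T ⟶ Y) (ht : t ≫ g = 0) :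
    ∃ l : T ⟶ X, l ≫ f = t := by
  obtain ⟨hl⟩ := E.isKernel _ h
  obtain ⟨l, hl'⟩ := KernelFork.IsLimit.lift' hl t ht
  exact ⟨l, hl'⟩

variable {E} in
lemma exists_desc_of_conflation {X Y Z : C} {f : X ⟶ Y} {g : Y ⟶ Z} {w : f ≫ g = 0}
    (h : E.conflation (ShortComplex.mk f g w)) {T : C} (t : Y ⟶ T) (ht : f ≫ t = 0) :
    ∃ d : Z ⟶ T, g ≫ d = t := by
  obtain ⟨hl⟩ := E.isCokernel _ h
  obtain ⟨d, hd⟩ := CokernelCofork.IsColimit.desc' hl t ht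
  exact ⟨d, hd⟩

/-- A deflation together with any of its kernels is a conflation. -/
lemma conflation_of_kernel {X Y Z : C} {f : X ⟶ Y} {g : Y ⟶ Z} (w : f ≫ g = 0)
    (hg : E.deflation g) [Mono f]
    (H : ∀ {T : C} (t : T ⟶ Y), t ≫ g = 0 → ∃ l : T ⟶ X, l ≫ f = t) :
    E.conflation (ShortComplex.mk f g w) := by
  obtain ⟨K, k, hk, hc⟩ := hg
  have := mono_of_conflation hc
  obtain ⟨a, ha⟩ := H k hk
  obtain ⟨b, hb⟩ := exists_lift_of_conflation hc f w
  let e : K ≅ X :=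
    { hom := a
      inv := b
      hom_inv_id := by rw [← cancel_mono k, Category.assoc, hb, ha, Category.id_comp]
      inv_hom_id := by rw [← cancel_mono f, Category.assoc, ha, hb, Category.id_comp] }
  refine E.conflation_of_iso ?_ hc
  exact ShortComplex.isoMk e (Iso.refl _) (Iso.refl _) (by simp [e, ha]) (by simp)

/-- An inflation together with any of its cokernels is a conflation. -/
lemma conflation_of_cokernel {X Y Z : C} {f : X ⟶ Y} {g : Y ⟶ Z} (w : f ≫ g = 0)
    (hf : E.inflation f) [Epi g]
    (H : ∀ {T : C} (t : Y ⟶ T), f ≫ t = 0 → ∃ d : Z ⟶ T, g ≫ d = t) :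
    E.conflation (ShortComplex.mk f g w) := by
  obtain ⟨K, k, hk, hc⟩ := hf
  have := epi_of_conflation hc
  obtain ⟨a, ha⟩ := H k hk
  obtain ⟨b, hb⟩ := exists_desc_of_conflation hc g w
  let e : K ≅ Z :=
    { hom := b
      inv := a
      hom_inv_id := by rw [← cancel_epi k, ← Category.assoc, hb, ha, Category.comp_id]
      inv_hom_id := by rw [← cancel_epi g, ← Category.assoc, ha, hb, Category.comp_id] }
  refine E.conflation_of_iso ?_ hc
  exact ShortComplex.isoMk (Iso.refl _) (Iso.refl _) e (by simp) (by simp [e, hb])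

lemma inflation_of_iso_target {X Y Y' : C} {f : X ⟶ Y} (hf : E.inflation f) (e : Y ≅ Y') :
    E.inflation (f ≫ e.hom) := by
  obtain ⟨Z, g, w, h⟩ := hf
  exact ⟨Z, e.inv ≫ g, by simp [w], by
    refine E.conflation_of_iso ?_ h
    exact ShortComplex.isoMk (Iso.refl _) e (Iso.refl _) (by simp) (by simp)⟩

lemma deflation_of_iso_source {Y Y' Z : C} {g : Y ⟶ Z} (hg : E.deflation g) (e : Y' ≅ Y) :
    E.deflation (e.hom ≫ g) := by
  obtain ⟨X, f, w, h⟩ := hg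
  exact ⟨X, f ≫ e.inv, by simp [w], by
    refine E.conflation_of_iso ?_ h
    exact ShortComplex.isoMk (Iso.refl _) e.symm (Iso.refl _) (by simp) (by simp)⟩

lemma inflation_of_isPushout {X Y X' Y' : C} {i : X ⟶ Y} {f : X ⟶ X'} {i' : X' ⟶ Y'}
    {f' : Y ⟶ Y'} (h : IsPushout f i i' f') (hi : E.inflation i) : E.inflation i' := by
  obtain ⟨P, j, g, hP, hj⟩ := E.pushout_inflation i f hi
  have := E.inflation_of_iso_target hj (hP.isoIsPushout _ _ h)
  simpa using this

lemma deflation_of_isPullback {Y Z Y' Z' : C} {p : Y ⟶ Z} {f : Z' ⟶ Z} {p' : Y' ⟶ Z'}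
    {f' : Y' ⟶ Y} (h : IsPullback f' p' p f) (hp : E.deflation p) : E.deflation p' := by
  obtain ⟨P, q, g, hP, hq⟩ := E.pullback_deflation p f hp
  have := E.deflation_of_iso_source hq (h.isoIsPullback _ _ hP)
  simpa using this

/-- A map out of the pushout that kills `i'` is determined by its restriction to `Y`, which kills
`i`; so the two inflations share a cokernel. -/
lemma exists_conflation_of_isPushout {X Y Z X' Y' : C} {i : X ⟶ Y} {q : Y ⟶ Z} {w : i ≫ q = 0}
    (hc : E.conflation (ShortComplex.mk i q w)) {f : X ⟶ X'} {i' : X' ⟶ Y'} {f' : Y ⟶ Y'}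
    (h : IsPushout f i i' f') :
    ∃ (q' : Y' ⟶ Z) (w' : i' ≫ q' = 0), f' ≫ q' = q ∧
      E.conflation (ShortComplex.mk i' q' w') := by
  have hi' := E.inflation_of_isPushout h ⟨_, _, _, hc⟩
  have := epi_of_conflation hc
  let q' : Y' ⟶ Z := h.desc 0 q (by simp [w])
  have hq : f' ≫ q' = q := h.inr_desc _ _ _
  have : Epi q' := by
    rw [← hq] at this
    exact epi_of_epi f' q'
  refine ⟨q', h.inl_desc _ _ _, hq, E.conflation_of_cokernel _ hi' fun t ht => ?_⟩
  obtain ⟨d, hd⟩ := exists_desc_of_conflation hc (f' ≫ t)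
    (by rw [← h.w_assoc, ht, comp_zero])
  refine ⟨d, h.hom_ext ?_ ?_⟩
  · rw [← Category.assoc, h.inl_desc, zero_comp, ht]
  · rw [← Category.assoc, hq, hd]

lemma exists_conflation_of_isPullback {X Y Z Y' Z' : C} {j : X ⟶ Y} {p : Y ⟶ Z} {w : j ≫ p = 0}
    (hc : E.conflation (ShortComplex.mk j p w)) {f : Z' ⟶ Z} {p' : Y' ⟶ Z'} {f' : Y' ⟶ Y}
    (h : IsPullback f' p' p f) :
    ∃ (j' : X ⟶ Y') (w' : j' ≫ p' = 0), j' ≫ f' = j ∧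
      E.conflation (ShortComplex.mk j' p' w') := by
  have hp' := E.deflation_of_isPullback h ⟨_, _, _, hc⟩
  have := mono_of_conflation hc
  let j' : X ⟶ Y' := h.lift j 0 (by simp [w])
  have hj : j' ≫ f' = j := h.lift_fst _ _ _
  have : Mono j' := by
    rw [← hj] at this
    exact mono_of_mono j' f'
  refine ⟨j', h.lift_snd _ _ _, hj, E.conflation_of_kernel _ hp' fun t ht => ?_⟩
  obtain ⟨l, hl⟩ := exists_lift_of_conflation hc (t ≫ f')
    (by rw [Category.assoc, h.w, ← Category.assoc, ht, zero_comp])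
  refine ⟨l, h.hom_ext ?_ ?_⟩
  · rw [Category.assoc, hj, hl]
  · rw [Category.assoc, h.lift_snd, comp_zero, ht]

/-- The identity is an inflation and its cokernel is a zero object. Pulling back such maps makes
biproduct projections deflations. -/
lemma deflation_to_zero [HasZeroObject C] (X : C) : E.deflation (0 : X ⟶ 0) := by
  obtain ⟨Z, g, w, h⟩ := E.id_inflation X
  have := epi_of_conflation h
  have hg : g = 0 := by simpa using w
  have hZ : IsZero Z := by
    rw [IsZero.iff_id_eq_zero, ← cancel_epi g, hg, zero_comp, zero_comp]
  exact ⟨X, 𝟙 X, by simp, by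
    refine E.conflation_of_iso ?_ h
    exact ShortComplex.isoMk (Iso.refl _) (Iso.refl _) (hZ.iso (isZero_zero C))
      (by simp) ((isZero_zero C).eq_of_tgt _ _)⟩

variable {E} in
/-- A conflation whose deflation has a section also has a compatible retraction. -/
lemma exists_retraction_of_section {X Y Z : C} {f : X ⟶ Y} {g : Y ⟶ Z} {w : f ≫ g = 0}
    (h : E.conflation (ShortComplex.mk f g w)) (s : Z ⟶ Y) (hs : s ≫ g = 𝟙 Z) :
    ∃ r : Y ⟶ X, f ≫ r = 𝟙 X ∧ s ≫ r = 0 ∧ r ≫ f + g ≫ s = 𝟙 Y := by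
  have := mono_of_conflation h
  obtain ⟨r, hr⟩ := exists_lift_of_conflation h (𝟙 Y - g ≫ s) (by simp [hs])
  refine ⟨r, ?_, ?_, ?_⟩
  · rw [← cancel_mono f, Category.assoc, hr]
    simp [reassoc_of% w]
  · rw [← cancel_mono f, Category.assoc, hr]
    simp [reassoc_of% hs]
  · rw [hr, sub_add_cancel]

end Conflations

/-! ### Split extensions, weak idempotent completeness and the lifting lemma. -/

section Biproducts

variable {C : Type u} [Category.{v} C] [Preadditive C] [HasZeroObject C]
  [HasBinaryBiproducts C] (E : ExactStructure C)

lemma conflation_inl_snd (X Y : C) :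
    E.conflation (ShortComplex.mk (biprod.inl : X ⟶ X ⊞ Y) biprod.snd biprod.inl_snd) := by
  have h : E.deflation (biprod.snd : X ⊞ Y ⟶ Y) :=
    E.deflation_of_isPullback (p := (0 : X ⟶ 0)) (f := (0 : Y ⟶ 0)) (f' := biprod.fst)
      (IsPullback.of_isLimit' ⟨by simp⟩ (PullbackCone.IsLimit.mk _
        (fun s => biprod.lift s.fst s.snd) (by simp) (by simp)
        (fun s m h₁ h₂ => by apply biprod.hom_ext <;> simp [h₁, h₂])))
      (E.deflation_to_zero X)
  refine E.conflation_of_kernel _ h fun t ht => ⟨t ≫ biprod.fst, ?_⟩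
  apply biprod.hom_ext <;> simp [ht]

/-- An equivalence with the split extension transports its section. Conversely, a section yields a
retraction, so both middle terms decompose and can be matched summand by summand. -/
lemma extVanishes_iff (A B : C) :
    E.ExtVanishes A B ↔ ∀ (M : C) (i : B ⟶ M) (p : M ⟶ A) (w : i ≫ p = 0),
      E.conflation (ShortComplex.mk i p w) → ∃ s : A ⟶ M, s ≫ p = 𝟙 A := by
  constructor
  · intro h M i p w hc
    let S : E.Extension A B := ⟨M, i, p, w, hc⟩
    let T : E.Extension A B := ⟨_, _, _, _, E.conflation_inl_snd B A⟩
    obtain ⟨e, -, he⟩ : (E.extensionSetoid A B).r T S :=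
      _root_.Quotient.exact (h.elim (_root_.Quotient.mk _ T) (_root_.Quotient.mk _ S))
    refine ⟨biprod.inr ≫ e.hom, ?_⟩
    rw [Category.assoc]
    exact (congrArg (fun t => biprod.inr ≫ t) he).trans biprod.inr_snd
  · intro h
    refine ⟨fun a b => ?_⟩
    induction a using _root_.Quotient.inductionOn with | _ S
    induction b using _root_.Quotient.inductionOn with | _ T
    apply _root_.Quotient.sound
    obtain ⟨s, hs⟩ := h _ _ _ _ S.conflation
    obtain ⟨t, ht⟩ := h _ _ _ _ T.conflation
    obtain ⟨r, hr₁, hr₂, hr₃⟩ := exists_retraction_of_section S.conflation s hs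
    obtain ⟨q, hq₁, hq₂, hq₃⟩ := exists_retraction_of_section T.conflation t ht
    refine ⟨⟨r ≫ T.i + S.p ≫ t, q ≫ S.i + T.p ≫ s, ?_, ?_⟩, ?_, ?_⟩
    · simp [reassoc_of% T.w, reassoc_of% hq₁, reassoc_of% hq₂, reassoc_of% ht, hr₃]
    · simp [reassoc_of% S.w, reassoc_of% hr₁, reassoc_of% hr₂, reassoc_of% hs, hq₃]
    · simp [reassoc_of% hr₁, reassoc_of% S.w]
    · simp [T.w, ht]

/-- In a weakly idempotent complete exact category, the second factor of a deflation
is a deflation. -/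
lemma deflation_of_comp (hE : E.IsWeaklyIdempotentComplete) {X Y Z : C} (f : X ⟶ Y) (g : Y ⟶ Z)
    (h : E.deflation (f ≫ g)) : E.deflation g := by
  -- Up to a shear automorphism of `Y ⊞ X`, the map `fst ≫ g` is `desc g (f ≫ g)`, which is a
  -- composite of two deflations. The spare summand `X` is removed afterwards.
  have h₁ : E.deflation (biprod.map (𝟙 Y) (f ≫ g)) :=
    E.deflation_of_isPullback (p := f ≫ g) (f := biprod.snd) (f' := biprod.snd)
      (IsPullback.of_isLimit' ⟨by simp⟩ (PullbackCone.IsLimit.mk _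
        (fun s => biprod.lift (s.snd ≫ biprod.fst) s.fst) (by simp)
        (fun s => by apply biprod.hom_ext <;> simp [s.condition])
        (fun s m h₁ h₂ => by apply biprod.hom_ext <;> simp [← h₁, ← h₂]))) h
  have h₂ : E.deflation (biprod.desc g (𝟙 Z)) := by
    have := E.deflation_of_iso_source (Y' := Y ⊞ Z) ⟨_, _, _, E.conflation_inl_snd Y Z⟩
      { hom := biprod.lift biprod.fst (biprod.desc g (𝟙 Z))
        inv := biprod.lift biprod.fst (biprod.desc (-g) (𝟙 Z))
        hom_inv_id := by ext <;> simp
        inv_hom_id := by ext <;> simp }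
    simpa using this
  have h₃ : E.deflation (biprod.fst ≫ g : Y ⊞ X ⟶ Z) := by
    have := E.deflation_of_iso_source (Y' := Y ⊞ X) (E.comp_deflation _ _ h₁ h₂)
      { hom := biprod.lift (biprod.desc (𝟙 Y) (-f)) biprod.snd
        inv := biprod.lift (biprod.desc (𝟙 Y) f) biprod.snd
        hom_inv_id := by ext <;> simp
        inv_hom_id := by ext <;> simp }
    convert this using 1
    have hm : biprod.map (𝟙 Y) (f ≫ g) ≫ biprod.desc g (𝟙 Z) = biprod.desc g (f ≫ g) := by
      ext <;> simp
    rw [hm, biprod.lift_desc]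
    ext <;> simp
  obtain ⟨N, n, hn, hN⟩ := h₃
  have := mono_of_conflation hN
  obtain ⟨a, ha⟩ := exists_lift_of_conflation hN (biprod.inr : X ⟶ Y ⊞ X) (by simp)
  -- `X` sits in the kernel `N` as a split subobject, so weak idempotent completeness provides the
  -- quotient `K`, the future kernel of `g`. Pushing out along `N ⟶ K` kills `X` in `Y ⊞ X` as well.
  obtain ⟨K, k, hk, hK⟩ := hE a (n ≫ biprod.snd) (by rw [reassoc_of% ha]; simp)
  obtain ⟨m, hm⟩ := exists_desc_of_conflation hK (n ≫ biprod.fst) (by rw [reassoc_of% ha]; simp)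
  have := epi_of_conflation hK
  have hP : IsPushout k n m biprod.fst :=
    IsPushout.of_isColimit' ⟨hm⟩ (PushoutCocone.IsColimit.mk _
      (fun s => biprod.inl ≫ s.inr)
      (fun s => by
        have hs : biprod.inr ≫ s.inr = 0 := by
          rw [← ha, Category.assoc, ← s.condition, reassoc_of% hk, zero_comp]
        have : biprod.fst ≫ biprod.inl ≫ s.inr = s.inr := by
          apply biprod.hom_ext' <;> simp [hs]
        rw [← cancel_epi k, reassoc_of% hm, this, s.condition])
      (fun s => by
        have hs : biprod.inr ≫ s.inr = 0 := by
          rw [← ha, Category.assoc, ← s.condition, reassoc_of% hk, zero_comp]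
        apply biprod.hom_ext' <;> simp [hs])
      (fun s t h₁ h₂ => by rw [← h₂]; simp))
  obtain ⟨q, hq, hq', hc⟩ := E.exists_conflation_of_isPushout hN hP
  obtain rfl : q = g := by
    rw [← cancel_epi (biprod.fst : Y ⊞ X ⟶ Y), hq']
  exact ⟨_, _, _, hc⟩

/-- In a weakly idempotent complete exact category, an inflation with cokernel `S` has the left
lifting property with respect to a deflation with kernel `Y` if `Ext¹(S, Y) = 0`. -/
lemma hasLiftingProperty_of_extVanishes (hE : E.IsWeaklyIdempotentComplete)
    {A B S Y M N : C} {i : A ⟶ B} {q : B ⟶ S} {w : i ≫ q = 0}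
    (hi : E.conflation (ShortComplex.mk i q w)) {j : Y ⟶ M} {p : M ⟶ N} {w' : j ≫ p = 0}
    (hp : E.conflation (ShortComplex.mk j p w')) (hext : E.ExtVanishes S Y) :
    HasLiftingProperty i p := by
  rw [extVanishes_iff] at hext
  refine ⟨fun {u v} sq => ?_⟩
  -- After pulling back along `v`, what is needed is a section of `p'` extending the partial section
  -- `h` on `A`.
  obtain ⟨W, p', v', hW, -⟩ := E.pullback_deflation p v ⟨_, _, _, hp⟩
  obtain ⟨j', wj, -, hj'⟩ := E.exists_conflation_of_isPullback hp hW
  let h : A ⟶ W := hW.lift u i sq.w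
  have hh : h ≫ p' = i := hW.lift_snd _ _ _
  -- `R` glues `W` and `B` along `A`. As `jB` is split by `ρ`, `R` is `B ⊕ Q`, with `τ` embedding
  -- `Q` as the kernel of `ρ`. The kernel of `σ` on `Q` is then that of `p'`, namely `Y`, giving an
  -- extension of `S` by `Y`.
  obtain ⟨R, jW, jB, hR, -⟩ := E.pushout_inflation i h ⟨_, _, _, hi⟩
  obtain ⟨σ, wσ, hσ, hcσ⟩ := E.exists_conflation_of_isPushout hi hR
  let ρ : R ⟶ B := hR.desc p' (𝟙 B) (by simp [hh])
  have hρ₁ : jW ≫ ρ = p' := hR.inl_desc _ _ _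
  have hρ₂ : jB ≫ ρ = 𝟙 B := hR.inr_desc _ _ _
  obtain ⟨Q, π, wπ, hQ⟩ := hE jB ρ hρ₂
  have := epi_of_conflation hQ
  have := mono_of_conflation hcσ
  have := mono_of_conflation hj'
  obtain ⟨τ, hτ⟩ := exists_desc_of_conflation hQ (𝟙 R - ρ ≫ jB)
    (by simp [reassoc_of% hρ₂])
  have hτπ : τ ≫ π = 𝟙 Q := by
    rw [← cancel_epi π, reassoc_of% hτ]
    simp [wπ]
  have hτρ : τ ≫ ρ = 0 := by
    rw [← cancel_epi π, reassoc_of% hτ]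
    simp [hρ₂]
  let g : Q ⟶ S := -(τ ≫ σ)
  have hg : π ≫ g = ρ ≫ q - σ := by
    simp [g, reassoc_of% hτ, hσ]
  have hWg : (jW ≫ π) ≫ g = p' ≫ q := by
    rw [Category.assoc, hg, Preadditive.comp_sub, reassoc_of% hρ₁, wσ, sub_zero]
  have hdg : E.deflation g := by
    refine E.deflation_of_comp hE (jW ≫ π) g ?_
    rw [hWg]
    exact E.comp_deflation _ _ ⟨_, _, _, hj'⟩ ⟨_, _, _, hi⟩
  have hlift : ∀ {T : C} (t : T ⟶ Q), t ≫ g = 0 → ∃ l : T ⟶ Y, l ≫ j' ≫ jW = t ≫ τ := by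
    intro T t ht
    obtain ⟨l, hl⟩ := exists_lift_of_conflation hcσ (t ≫ τ) (by simpa [g] using ht)
    obtain ⟨l', hl'⟩ := exists_lift_of_conflation hj' l
      (by rw [← hρ₁, reassoc_of% hl, hτρ, comp_zero])
    exact ⟨l', by rw [reassoc_of% hl', hl]⟩
  have hjτ : j' ≫ jW ≫ π ≫ τ = j' ≫ jW := by
    rw [hτ]
    simp [reassoc_of% hρ₁, reassoc_of% wj]
  have : Mono (j' ≫ jW ≫ π) := by
    have : Mono ((j' ≫ jW ≫ π) ≫ τ) := by
      simp only [Category.assoc, hjτ]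
      exact mono_comp _ _
    exact mono_of_mono _ τ
  have hcg : E.conflation (ShortComplex.mk (j' ≫ jW ≫ π) g
      (by rw [Category.assoc, hWg, reassoc_of% wj, zero_comp])) := by
    refine E.conflation_of_kernel _ hdg fun t ht => ?_
    obtain ⟨l, hl⟩ := hlift t ht
    exact ⟨l, by rw [reassoc_of% hl, hτπ, Category.comp_id]⟩
  obtain ⟨s, hs⟩ := hext _ _ _ _ hcg
  have hs' : s ≫ τ ≫ σ = -𝟙 S := by
    rw [← hs]; simp [g]
  -- The splitting `s` corrects `jB` so that it lands in `W`, the kernel of `σ`. The correction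
  -- vanishes on `A` and under `ρ`, so the result extends `h` and is a section of `p'`.
  obtain ⟨l, hl⟩ := exists_lift_of_conflation hcσ (jB + q ≫ s ≫ τ) (by simp [hσ, hs'])
  have hl₁ : l ≫ p' = 𝟙 B := by
    rw [← hρ₁, reassoc_of% hl]
    simp [hρ₂, hτρ]
  have hl₂ : i ≫ l = h := by
    rw [← cancel_mono jW, Category.assoc, hl, hR.w]
    simp [reassoc_of% w]
  exact ⟨⟨⟨l ≫ v', by rw [← Category.assoc, hl₂, hW.lift_fst],
    by rw [Category.assoc, hW.w, ← Category.assoc, hl₁, Category.id_comp]⟩⟩⟩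

end Biproducts

end ExactStructure

/-! ### Constructing functors on a well-order by transfinite recursion. -/

section TransfiniteRecursion

universe w

variable {C : Type u} [Category.{v} C] {J : Type w} [LinearOrder J] [WellFoundedLT J]

/-- A functor defined on `K` realizes the family of arrows `R` indexed by `J` along `φ`. -/
def RealizesArrows {K : Type*} [Preorder K] (φ : K → J) (R : J → J → Arrow C) (F : K ⥤ C) :
    Prop :=
  ∀ ⦃x y : K⦄ (f : x ⟶ y), Arrow.mk (F.map f) = R (φ y) (φ x)

variable (step : ∀ (j : J) (F : Set.Iio j ⥤ C), Cocone F)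

open scoped Classical in
/-- The arrows `X_a ⟶ X_b` of the diagram constructed by transfinite recursion from `step`,
as a function of `b` and `a`. -/
noncomputable def recursionArrows (X₀ : C) : J → J → Arrow C :=
  wellFounded_lt.fix fun b R =>
    if h : ∃ F : Set.Iio b ⥤ C, ∀ ⦃x y : Set.Iio b⦄ (f : x ⟶ y),
        Arrow.mk (F.map f) = R y.1 y.2 x.1 then
      fun a => if ha : a < b then Arrow.mk ((step b h.choose).ι.app ⟨a, ha⟩)
        else Arrow.mk (𝟙 (step b h.choose).pt)
    -- Junk value: every stage turns out to be realized by a functor, so this branch is never taken.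
    else fun _ => Arrow.mk (𝟙 X₀)

variable (X₀ : C)

/-- A functor is determined by its arrows, so the functor chosen in the recursion is `F` itself.
Recording arrows turns coherence between stages into plain equalities. -/
lemma recursionArrows_eq {j : J} {F : Set.Iio j ⥤ C}
    (hF : RealizesArrows Subtype.val (recursionArrows step X₀) F) (a : J) :
    (∀ ha : a < j, recursionArrows step X₀ j a = Arrow.mk ((step j F).ι.app ⟨a, ha⟩)) ∧
    (¬ a < j → recursionArrows step X₀ j a = Arrow.mk (𝟙 (step j F).pt)) := by
  have h : ∃ F : Set.Iio j ⥤ C, ∀ ⦃x y : Set.Iio j⦄ (f : x ⟶ y),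
      Arrow.mk (F.map f) = recursionArrows step X₀ y.1 x.1 := ⟨F, hF⟩
  have hc : h.choose = F :=
    Arrow.functor_ext fun x y f => (h.choose_spec f).trans (hF f).symm
  have key : recursionArrows step X₀ j a =
      if ha : a < j then Arrow.mk ((step j h.choose).ι.app ⟨a, ha⟩)
        else Arrow.mk (𝟙 (step j h.choose).pt) :=
    (congrFun (WellFounded.fix_eq _ _ _) a).trans (congrFun (dif_pos h) a)
  rw [hc] at key
  exact ⟨fun ha => by rw [key, dif_pos ha], fun ha => by rw [key, dif_neg ha]⟩

/-- Allowing any `φ` covers both uses: initial segments in the induction, and then all of `J`. -/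
lemma exists_realizesArrows {K : Type*} [LinearOrder K] (φ : K ↪o J)
    (H : ∀ k : K, ∃ F : Set.Iio (φ k) ⥤ C,
      RealizesArrows Subtype.val (recursionArrows step X₀) F) :
    ∃ G : K ⥤ C, RealizesArrows φ (recursionArrows step X₀) G := by
  classical
  choose F hF using H
  have hlt : ∀ {a b : K}, a < b → φ a < φ b := fun h => φ.lt_iff_lt.2 h
  have hobj : ∀ {a b : K} (h : a < b),
      (step _ (F a)).pt = (F b).obj ⟨φ a, hlt h⟩ := fun {a b} h => by
    have h₁ := hF b (𝟙 (⟨φ a, hlt h⟩ : Set.Iio (φ b)))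
    rw [(recursionArrows_eq step X₀ (hF a) (φ a)).2 (lt_irrefl _)] at h₁
    exact (congrArg (fun f : Arrow C => f.left) h₁).symm
  have hle : ∀ {a b : K}, (a ⟶ b) → ¬ a < b → a = b := fun f h =>
    le_antisymm (leOfHom f) (not_lt.1 h)
  let m : ∀ {a b : K}, (a ⟶ b) → ((step _ (F a)).pt ⟶ (step _ (F b)).pt) := fun {a b} f =>
    if h : a < b then eqToHom (hobj h) ≫ (step _ (F b)).ι.app ⟨φ a, hlt h⟩
    else eqToHom (by rw [hle f h])
  have hm_lt : ∀ {a b : K} (f : a ⟶ b) (h : a < b),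
      m f = eqToHom (hobj h) ≫ (step _ (F b)).ι.app ⟨φ a, hlt h⟩ := fun f h => dif_pos h
  have hm_id : ∀ {a : K} (f : a ⟶ a), m f = 𝟙 _ := fun f => dif_neg (lt_irrefl _)
  have hm : ∀ {a b : K} (f : a ⟶ b), Arrow.mk (m f) = recursionArrows step X₀ (φ b) (φ a) := by
    intro a b f
    by_cases h : a < b
    · rw [hm_lt f h, (recursionArrows_eq step X₀ (hF b) (φ a)).1 (hlt h),
        Arrow.arrow_mk_eqToHom_comp]
    · obtain rfl := hle f h
      rw [hm_id f, (recursionArrows_eq step X₀ (hF a) (φ a)).2 (lt_irrefl _)]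
  refine ⟨{ obj := fun a => (step _ (F a)).pt, map := fun f => m f, map_id := fun a => hm_id (𝟙 a),
            map_comp := fun {a b c} f g => ?_ }, fun x y f => hm f⟩
  by_cases hab : a < b
  swap
  · obtain rfl := hle f hab
    rw [hm_id f, Category.id_comp]
  by_cases hbc : b < c
  swap
  · obtain rfl := hle g hbc
    rw [hm_id g, Category.comp_id]
  have hφ : (⟨φ a, hlt (hab.trans hbc)⟩ : Set.Iio (φ c)) ≤ ⟨φ b, hlt hbc⟩ := (hlt hab).le
  have h₁ := hF c (homOfLE hφ)
  rw [(recursionArrows_eq step X₀ (hF b) (φ a)).1 (hlt hab), Arrow.mk_eq_mk_iff] at h₁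
  obtain ⟨h₂, h₃, h₄⟩ := h₁
  rw [hm_lt (f ≫ g) (hab.trans hbc), hm_lt f hab, hm_lt g hbc,
    ← (step _ (F c)).w (homOfLE hφ), h₄]
  simp

/-- Transfinite recursion: if `step` extends every diagram indexed by `Set.Iio j` to a diagram
indexed by `Set.Iic j` (by providing a cocone), there is a diagram indexed by `J` all of whose
stages are obtained by `step`. -/
theorem exists_functor_of_step [Nonempty C] :
    ∃ G : J ⥤ C, ∀ j : J, Nonempty
      (step j ((Set.principalSegIio j).monotone.functor ⋙ G) ≅
        (Set.principalSegIio j).cocone G) := by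
  let X₀ : C := Classical.arbitrary C
  have H : ∀ j : J, ∃ F : Set.Iio j ⥤ C,
      RealizesArrows Subtype.val (recursionArrows step X₀) F := by
    intro j
    induction j using WellFoundedLT.induction with | _ j ih
    exact exists_realizesArrows step X₀ (OrderEmbedding.subtype (· ∈ Set.Iio j))
      (fun k => ih k.1 k.2)
  obtain ⟨G, hG⟩ := exists_realizesArrows step X₀ (RelEmbedding.refl _ : J ↪o J) H
  refine ⟨G, fun j => ?_⟩
  have hG' : RealizesArrows Subtype.val (recursionArrows step X₀)
      ((Set.principalSegIio j).monotone.functor ⋙ G) := fun x y f => hG _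
  have h₁ := hG (𝟙 j)
  rw [G.map_id] at h₁
  have h₂ := h₁.trans ((recursionArrows_eq step X₀ hG' j).2 (lt_irrefl _))
  have h₃ : G.obj j = (step j ((Set.principalSegIio j).monotone.functor ⋙ G)).pt :=
    congrArg (fun f : Arrow C => f.left) h₂
  refine ⟨Cocone.ext (eqToIso h₃.symm) fun a => ?_⟩
  have h₄ := (hG (homOfLE (le_of_lt a.2))).trans ((recursionArrows_eq step X₀ hG' a.1).1 a.2)
  rw [Arrow.mk_eq_mk_iff] at h₄
  obtain ⟨h₅, h₆, h₇⟩ := h₄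
  have : ((Set.principalSegIio j).cocone G).ι.app a = G.map (homOfLE (le_of_lt a.2)) := rfl
  rw [this]
  exact (Category.id_comp _).symm.trans h₇.symm

end TransfiniteRecursion

/-! ### Ordinal bookkeeping and closure ordinals. -/

section Ordinals

open Ordinal Order

/-- The remainder of an ordinal after removing its leading power of `2`. -/
noncomputable def ordinalTail (j : Ordinal.{v}) : Ordinal.{v} := j - 2 ^ log 2 j

lemma log_two_opow_add {x w : Ordinal.{v}} (h : w < 2 ^ x) : log 2 (2 ^ x + w) = x := by
  simpa using log_opow_mul_add (v := 1) _root_.one_lt_two one_ne_zero h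

lemma ordinalTail_two_opow_add {x w : Ordinal.{v}} (h : w < 2 ^ x) :
    ordinalTail (2 ^ x + w) = w := by
  rw [ordinalTail, log_two_opow_add h, Ordinal.add_sub_cancel]

/-- A map from ordinals to pairs of ordinals, every pair `(β, ξ)` being the image of some
ordinal, necessarily at least `β`. -/
lemma exists_ordinal_bookkeeping :
    ∃ e : Ordinal.{v} → Ordinal.{v} × Ordinal.{v},
      (∀ j, (e j).1 ≤ j) ∧ Function.Surjective e := by
  refine ⟨fun j => (ordinalTail j, ordinalTail (log 2 j)), fun j => Ordinal.sub_le_self _ _, ?_⟩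
  rintro ⟨β, ξ⟩
  have hlt : max β ξ < 2 ^ succ (max β ξ) :=
    (lt_succ _).trans_le (right_le_opow _ _root_.one_lt_two)
  have hξ : ξ < 2 ^ succ (max β ξ) := (le_max_right _ _).trans_lt hlt
  have hβ : β < 2 ^ (2 ^ succ (max β ξ) + ξ) :=
    ((le_max_left _ _).trans_lt hlt).trans_le
      ((le_self_add).trans (right_le_opow _ _root_.one_lt_two))
  -- The tail encodes `β` and the tail of the exponent encodes `ξ`; the inner power is large enough
  -- that both are genuine remainders.
  refine ⟨2 ^ (2 ^ succ (max β ξ) + ξ) + β, ?_⟩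
  simp only [log_two_opow_add hβ, ordinalTail_two_opow_add hβ, ordinalTail_two_opow_add hξ]

/-- There are limit ordinals of arbitrarily large cofinality that are closed under a given
function. -/
lemma exists_closed_ordinal (s : Ordinal.{v} → Ordinal.{v}) (κ : Cardinal.{v}) :
    ∃ l : Ordinal.{v}, κ < l.cof ∧ IsSuccLimit l ∧ ∀ β < l, s β < l := by
  let t : Ordinal.{v} → Ordinal.{v} := fun o => ⨆ β : Set.Iio o, succ (s β)
  -- `L` is strictly increasing and each value exceeds `s` on everything below the earlier values.
  -- Its supremum over a regular length `μ.ord` is closed under `s` and has cofinality `μ`.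
  let L : Ordinal.{v} → Ordinal.{v} := wellFounded_lt.fix fun a L =>
    ⨆ b : Set.Iio a, succ (max (L b.1 b.2) (t (L b.1 b.2)))
  have hL : ∀ a, L a = ⨆ b : Set.Iio a, succ (max (L b) (t (L b))) := fun a =>
    WellFounded.fix_eq _ _ _
  have hL' : ∀ {b a}, b < a → max (L b) (t (L b)) < L a := fun {b a} h => by
    rw [hL a]
    exact (lt_succ _).trans_le
      (Ordinal.le_iSup (fun b : Set.Iio a => succ (max (L b) (t (L b)))) ⟨b, h⟩)
  have hmono : StrictMono L := fun b a h => (le_max_left _ _).trans_lt (hL' h)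
  let μ : Cardinal.{v} := succ (max κ Cardinal.aleph0)
  have hμ : μ.IsRegular := Cardinal.isRegular_succ (le_max_right _ _)
  have hlim : IsSuccLimit μ.ord := Cardinal.isSuccLimit_ord hμ.aleph0_le
  have hcof : (⨆ a : Set.Iio μ.ord, L a).cof = μ := by
    rw [cof_iSup_Iio (f := fun a => L a) (hmono.comp (Subtype.strictMono_coe _))
      hlim.isSuccPrelimit, hμ.cof_ord]
  refine ⟨⨆ a : Set.Iio μ.ord, L a, ?_, ?_, fun β hβ => ?_⟩
  · rw [hcof]
    exact (le_max_left _ _).trans_lt (lt_succ _)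
  · rw [← Ordinal.one_lt_cof_iff, hcof]
    exact Cardinal.one_lt_aleph0.trans_le hμ.aleph0_le
  · obtain ⟨a, ha⟩ := Ordinal.lt_iSup_iff.1 hβ
    have h₁ : s β < t (L a) := (lt_succ _).trans_le
      (Ordinal.le_iSup (fun β : Set.Iio (L a) => succ (s β)) ⟨β, ha⟩)
    exact (h₁.trans_le ((le_max_right _ _).trans (hL' (lt_succ a.1)).le)).trans_le
      (Ordinal.le_iSup (fun a : Set.Iio μ.ord => L a) ⟨succ a.1, hlim.succ_lt a.2⟩)

end Ordinals

/-! ### The small object argument, one cell at a time. -/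

section SmallObjectArgument

variable {C : Type u} [Category.{v} C]

/-- The lifting problems of morphisms in `I` against `X.hom : X.left ⟶ B`. -/
def LiftingProblem (I : MorphismProperty C) {B : C} (X : Over B) : Type (max u v) :=
  Σ a : I.toSet, { p : (a.1.left ⟶ X.left) × (a.1.right ⟶ B) // p.1 ≫ X.hom = a.1.hom ≫ p.2 }

namespace LiftingProblem

variable {I : MorphismProperty C} {B : C}

instance [MorphismProperty.IsSmall.{v} I] (X : Over B) : Small.{v} (LiftingProblem I X) :=
  inferInstanceAs (Small.{v} (Σ a : I.toSet,
    { p : (a.1.left ⟶ X.left) × (a.1.right ⟶ B) // p.1 ≫ X.hom = a.1.hom ≫ p.2 }))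

/-- The functoriality of lifting problems. -/
def map {X Y : Over B} (p : LiftingProblem I X) (g : X ⟶ Y) : LiftingProblem I Y :=
  ⟨p.1, ⟨(p.2.1.1 ≫ g.left, p.2.1.2), by simp [p.2.2]⟩⟩

/-- The morphism `g : X ⟶ Y` over `B` is obtained by attaching a cell along the lifting
problem `p`. -/
def IsAttachment {X Y : Over B} (p : LiftingProblem I X) (g : X ⟶ Y) : Prop :=
  ∃ t : p.1.1.right ⟶ Y.left, IsPushout p.2.1.1 p.1.1.hom g.left t ∧ t ≫ Y.hom = p.2.1.2

lemma IsAttachment.comp_iso {X Y Y' : Over B} {p : LiftingProblem I X} {g : X ⟶ Y}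
    (h : p.IsAttachment g) (e : Y ≅ Y') : p.IsAttachment (g ≫ e.hom) := by
  obtain ⟨t, ht, ht'⟩ := h
  refine ⟨t ≫ e.hom.left, ?_, by simp [ht']⟩
  exact ht.of_iso (Iso.refl _) (Iso.refl _) (Iso.refl _) ((Over.forget B).mapIso e)
    (by simp) (by simp) (by simp) (by simp)

lemma IsAttachment.pushouts {X Y : Over B} {p : LiftingProblem I X} {g : X ⟶ Y}
    (h : p.IsAttachment g) : I.pushouts g.left := by
  obtain ⟨t, ht, -⟩ := h
  exact ⟨_, _, _, _, _, p.1.2, ht⟩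

lemma exists_isAttachment {X : Over B} (p : LiftingProblem I X)
    (hpo : ∀ {P Q P' : C} (i : P ⟶ Q) (f : P ⟶ P'), I i →
      ∃ (Q' : C) (i' : P' ⟶ Q') (f' : Q ⟶ Q'), IsPushout f i i' f') :
    ∃ (Y : Over B) (g : X ⟶ Y), p.IsAttachment g := by
  obtain ⟨Q, i, t, h⟩ := hpo p.1.1.hom p.2.1.1 p.1.2
  exact ⟨Over.mk (h.desc X.hom p.2.1.2 p.2.2), Over.homMk i (by simp), t, h, by simp⟩

/-- The lifting problems form a small type, which embeds into the ordinals; a left inverse of the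
embedding is an enumeration. -/
lemma exists_enumeration [MorphismProperty.IsSmall.{v} I] (X : Over B)
    [Nonempty (LiftingProblem I X)] :
    ∃ φ : Ordinal.{v} → LiftingProblem I X, Function.Surjective φ := by
  obtain ⟨ψ⟩ := nonempty_embedding_to_cardinal (α := Shrink.{v} (LiftingProblem I X))
  have h : Function.Injective fun p : LiftingProblem I X => (ψ (equivShrink _ p)).ord :=
    Cardinal.ord_injective.comp (ψ.injective.comp (equivShrink _).injective)
  exact ⟨_, Function.invFun_surjective h⟩

end LiftingProblem

/-- The initial segment embedding of `o.ToType` into the ordinals. -/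
noncomputable def principalSegOfOrdinal (o : Ordinal.{v}) : o.ToType <i Ordinal.{v} :=
  PrincipalSeg.relIsoTrans Ordinal.ToType.mk.symm.toRelIsoLT (Set.principalSegIio o)

/-- A diagram indexed by all ordinals, obtained by attaching cells one at a time so that every
lifting problem at every stage is solved at some later stage, and taking colimits at limit
ordinals whenever they exist. -/
lemma exists_cellular_diagram (I : MorphismProperty C) [MorphismProperty.IsSmall.{v} I]
    (hpo : ∀ {P Q P' : C} (i : P ⟶ Q) (f : P ⟶ P'), I i →
      ∃ (Q' : C) (i' : P' ⟶ Q') (f' : Q ⟶ Q'), IsPushout f i i' f')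
    {A B : C} (f : A ⟶ B) (hne : ∀ X : Over B, Nonempty (LiftingProblem I X)) :
    ∃ G : Ordinal.{v} ⥤ Over B,
      Nonempty (Over.mk f ≅ G.obj ⊥) ∧
      (∀ k : Ordinal.{v}, ∃ p : LiftingProblem I (G.obj k),
        p.IsAttachment (G.map (homOfLE (Order.le_succ k)))) ∧
      (∀ (k : Ordinal.{v}) (p : LiftingProblem I (G.obj k)),
        ∃ (l : Ordinal.{v}) (h : k ≤ l),
          (p.map (G.map (homOfLE h))).IsAttachment (G.map (homOfLE (Order.le_succ l)))) ∧
      (∀ k : Ordinal.{v}, Order.IsSuccLimit k →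
        HasColimit ((Set.principalSegIio k).monotone.functor ⋙ G ⋙ Over.forget B) →
        Nonempty (IsColimit ((Set.principalSegIio k).cocone (G ⋙ Over.forget B)))) := by
  obtain ⟨e, he, hsurj⟩ := exists_ordinal_bookkeeping.{v}
  choose enum henum using fun X : Over B => LiftingProblem.exists_enumeration (I := I) X
  -- If `e k = (β, ξ)`, the cell attached at stage `k` solves the `ξ`-th problem of the earlier
  -- stage `β`, transported to `k`.
  let prob : ∀ {j : Ordinal.{v}} (F : Set.Iio j ⥤ Over B) (k : Set.Iio j),
      LiftingProblem I (F.obj k) := fun F k =>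
    (enum (F.obj ⟨(e k.1).1, (he k.1).trans_lt k.2⟩) (e k.1).2).map
      (F.map (homOfLE (he k.1)))
  have H : ∀ (j : Ordinal.{v}) (F : Set.Iio j ⥤ Over B), ∃ c : Cocone F,
      (j = ⊥ → Nonempty (Over.mk f ≅ c.pt)) ∧
      (∀ k : Set.Iio j, j = Order.succ k.1 → (prob F k).IsAttachment (c.ι.app k)) ∧
      (Order.IsSuccLimit j → HasColimit (F ⋙ Over.forget B) →
        Nonempty (IsColimit ((Over.forget B).mapCocone c))) := by
    intro j F
    induction j using Ordinal.limitRecOn with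
    | zero =>
      have hx : ∀ x : Set.Iio (0 : Ordinal.{v}), False := fun x =>
        not_lt_bot (show x.1 < ⊥ from x.2)
      exact ⟨⟨Over.mk f, ⟨fun x => (hx x).elim, fun x => (hx x).elim⟩⟩,
        fun _ => ⟨Iso.refl _⟩, fun k => (hx k).elim, fun h => (h.ne_bot rfl).elim⟩
    | add_one k =>
      let k' : Set.Iio (k + 1) := ⟨k, Order.lt_succ k⟩
      have hk' : ∀ x : Set.Iio (k + 1), x ≤ k' := fun x =>
        Subtype.coe_le_coe.1 (Order.lt_succ_iff.1 (show x.1 < Order.succ k from x.2))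
      obtain ⟨Y, g, hg⟩ := (prob F k').exists_isAttachment hpo
      refine ⟨⟨Y, ⟨fun x => F.map (homOfLE (hk' x)) ≫ g, fun x y φ => ?_⟩⟩,
        fun h => (Order.succ_ne_bot k h).elim, fun x hx => ?_,
        fun h => (Order.not_isSuccLimit_succ k h).elim⟩
      · dsimp
        rw [Category.comp_id, ← Category.assoc, ← F.map_comp]
        rfl
      · obtain rfl : x = k' := Subtype.ext (Order.succ_injective hx).symm
        have : F.map (homOfLE (hk' k')) ≫ g = g := by
          rw [show homOfLE (hk' k') = 𝟙 k' from rfl, F.map_id, Category.id_comp]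
        dsimp only
        rw [this]
        exact hg
    | limit j hj =>
      by_cases hF : HasColimit (F ⋙ Over.forget B)
      · exact ⟨colimit.cocone F, fun h => (hj.ne_bot h).elim,
          fun k hk => (Order.not_isSuccLimit_succ k.1 (hk ▸ hj)).elim,
          fun _ _ => ⟨isColimitOfPreserves (Over.forget B) (colimit.isColimit F)⟩⟩
      -- Without a colimit, the terminal object of `Over B` serves as a default cocone point.
      · exact ⟨⟨Over.mk (𝟙 B), ⟨fun x => Over.homMk (F.obj x).hom, fun x y φ => by
          ext; simp⟩⟩, fun h => (hj.ne_bot h).elim,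
          fun k hk => (Order.not_isSuccLimit_succ k.1 (hk ▸ hj)).elim,
          fun _ h => (hF h).elim⟩
  choose step h₀ hs hl using H
  have : Nonempty (Over B) := ⟨Over.mk f⟩
  obtain ⟨G, hG⟩ := exists_functor_of_step step
  have hatt : ∀ k : Ordinal.{v}, ((enum (G.obj (e k).1) (e k).2).map
      (G.map (homOfLE (he k)))).IsAttachment (G.map (homOfLE (Order.le_succ k))) := fun k => by
    obtain ⟨ε⟩ := hG (Order.succ k)
    have := (hs _ ((Set.principalSegIio (Order.succ k)).monotone.functor ⋙ G)
      ⟨k, Order.lt_succ k⟩ rfl).comp_iso ((Cocone.forget _).mapIso ε)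
    have h₂ : (step (Order.succ k) _).ι.app ⟨k, Order.lt_succ k⟩ ≫
      ((Cocone.forget _).mapIso ε).hom = G.map (homOfLE (Order.le_succ k)) := ε.hom.w _
    rw [h₂] at this
    exact this
  refine ⟨G, ?_, fun k => ⟨_, hatt k⟩, fun k p => ?_, fun k hk hcol => ?_⟩
  · obtain ⟨ε⟩ := hG ⊥
    obtain ⟨i⟩ := h₀ ⊥ ((Set.principalSegIio (⊥ : Ordinal.{v})).monotone.functor ⋙ G) rfl
    exact ⟨i ≪≫ (Cocone.forget _).mapIso ε⟩
  · obtain ⟨ξ, rfl⟩ := henum _ p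
    obtain ⟨l, hlk⟩ := hsurj (k, ξ)
    obtain ⟨rfl, rfl⟩ := Prod.ext_iff.1 hlk
    exact ⟨l, he l, hatt l⟩
  · obtain ⟨ε⟩ := hG k
    obtain ⟨hc⟩ := hl k ((Set.principalSegIio k).monotone.functor ⋙ G) hk hcol
    exact ⟨IsColimit.ofIsoColimit hc ((Cocone.functoriality _ (Over.forget B)).mapIso ε)⟩

/-- Transports a diagram on the large order of all ordinals to `o.ToType`, which lives in the
universe required of index types. -/
lemma isTransfiniteSequence_of_ordinal {D : MorphismProperty C} (X : Ordinal.{v} ⥤ C)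
    (o : Ordinal.{v}) [OrderBot o.ToType]
    (hstep : ∀ k : Ordinal.{v}, D (X.map (homOfLE (Order.le_succ k))))
    (hlim : ∀ k < o, Order.IsSuccLimit k →
      Nonempty (IsColimit ((Set.principalSegIio k).cocone X))) :
    IsTransfiniteSequence D ((principalSegOfOrdinal o).monotone.functor ⋙ X) where
  continuous := ⟨fun m hm => by
    obtain ⟨hc⟩ := hlim (principalSegOfOrdinal o m) ((principalSegOfOrdinal o).lt_top m)
      ((principalSegOfOrdinal o).isSuccLimit_apply_iff.2 hm)
    let ψ := (Set.principalSegIio m).transInitial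
      (principalSegOfOrdinal o : o.ToType ≤i Ordinal.{v})
    exact ⟨hc.whiskerEquivalence ψ.orderIsoIio.equivalence⟩⟩
  map_mem k hk := by
    have h : ∀ {a b : Ordinal.{v}} (_ : a ⋖ b) (φ : a ⟶ b), D (X.map φ) := fun {a b} hab φ => by
      obtain rfl := hab.succ_eq
      exact hstep a
    exact h ((principalSegOfOrdinal o).apply_covBy_apply_iff.2
      (Order.covBy_succ_of_not_isMax hk)) _

/-- As `I` is small, the supremum of the individual cardinals works for all domains at once. -/
lemma exists_isSmallRelativeTo {I : MorphismProperty C} [MorphismProperty.IsSmall.{v} I]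
    (hsmall : AdmitsSmallObjectArgument I) :
    ∃ κ : Cardinal.{v}, ∀ {P Q : C} (i : P ⟶ Q), I i →
      IsSmallRelativeTo κ (relativeCells I) P := by
  choose κ hκ using fun a : I.toSet => hsmall.small_domain a.1.hom a.2
  refine ⟨⨆ a, κ a, fun {P Q} i hi J _ _ _ _ F hJ hF => ?_⟩
  exact hκ ⟨Arrow.mk i, hi⟩ J F
    ((le_ciSup (Cardinal.bddAbove_of_small) (⟨Arrow.mk i, hi⟩ : I.toSet)).trans_lt hJ) hF

/-- The small object argument: every morphism is a relative `I`-cell complex followed by a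
morphism with the right lifting property with respect to `I`. -/
theorem AdmitsSmallObjectArgument.exists_factorization [HasZeroMorphisms C]
    {I : MorphismProperty C} [MorphismProperty.IsSmall.{v} I]
    (hsmall : AdmitsSmallObjectArgument I)
    (hpo : ∀ {P Q P' : C} (i : P ⟶ Q) (f : P ⟶ P'), I i →
      ∃ (Q' : C) (i' : P' ⟶ Q') (f' : Q ⟶ Q'), IsPushout f i i' f')
    {A B : C} (f : A ⟶ B) :
    ∃ (X : C) (j : A ⟶ X) (p : X ⟶ B), relativeCells I j ∧ I.rlp p ∧ j ≫ p = f := by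
  -- Enumerating lifting problems needs at least one: any morphism in `I` supplies the zero square.
  -- For empty `I`, the identity suffices, as a composition over a one-element order.
  by_cases hI : Nonempty I.toSet
  swap
  · refine ⟨A, 𝟙 A, f, ?_, fun P Q i hi => (hI ⟨⟨Arrow.mk i, hi⟩⟩).elim, Category.id_comp f⟩
    exact MorphismProperty.transfiniteCompositionsOfShape_le_transfiniteCompositions _
      (Shrink.{v} (Fin 1)) _
      ⟨(MorphismProperty.TransfiniteCompositionOfShape.id I.pushouts A).ofOrderIso
        (orderIsoShrink.{v} (Fin 1)).symm⟩
  obtain ⟨a⟩ := hI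
  obtain ⟨G, ⟨ε⟩, hatt, hsolve, hlim⟩ := exists_cellular_diagram I hpo f
    (fun X => ⟨⟨a, ⟨(0, 0), by simp⟩⟩⟩)
  have hpush : ∀ k, I.pushouts ((G ⋙ Over.forget B).map (homOfLE (Order.le_succ k))) := fun k =>
    (hatt k).choose_spec.pushouts
  -- Once the limit stages below `k` are known to be colimits, the diagram below `k` is a
  -- transfinite sequence, so its colimit exists and stage `k` was not a default.
  have hcolim : ∀ k : Ordinal.{v}, Order.IsSuccLimit k →
      Nonempty (IsColimit ((Set.principalSegIio k).cocone (G ⋙ Over.forget B))) := by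
    intro k
    induction k using WellFoundedLT.induction with | _ k ih
    intro hk
    have : Nonempty k.ToType := Ordinal.nonempty_toType_iff.2 hk.ne_bot
    let : OrderBot k.ToType := WellFoundedLT.toOrderBot _
    have : HasColimit ((Ordinal.ToType.mk (o := k)).symm.equivalence.functor ⋙
        (Set.principalSegIio k).monotone.functor ⋙ G ⋙ Over.forget B) :=
      hsmall.hasColimit _ _ (isTransfiniteSequence_of_ordinal _ k hpush ih)
    exact hlim k hk (hasColimit_of_equivalence_comp
      (Ordinal.ToType.mk (o := k)).symm.equivalence)
  obtain ⟨κ, hκ⟩ := exists_isSmallRelativeTo hsmall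
  choose l hkl hl using hsolve
  -- Closure makes every problem posed before `o` solved before `o`; the cofinality makes every map
  -- from a domain of `I` into stage `o` factor through an earlier stage.
  obtain ⟨o, hoκ, ho, hclosed⟩ := exists_closed_ordinal
    (fun k => ⨆ p : LiftingProblem I (G.obj k), Order.succ (l k p)) κ
  have : Nonempty o.ToType := Ordinal.nonempty_toType_iff.2 ho.ne_bot
  let : OrderBot o.ToType := WellFoundedLT.toOrderBot _
  obtain ⟨hc⟩ := hcolim o ho
  let φ := principalSegOfOrdinal o
  have hseq := isTransfiniteSequence_of_ordinal (D := I.pushouts) _ o hpush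
    (fun k _ hk => hcolim k hk)
  have hseq' : IsTransfiniteSequence (relativeCells I) (φ.monotone.functor ⋙ G ⋙ Over.forget B) :=
    ⟨hseq.continuous, fun k hk =>
      MorphismProperty.le_transfiniteCompositions _ _ (hseq.map_mem k hk)⟩
  have hc' : IsColimit (φ.cocone (G ⋙ Over.forget B)) :=
    hc.whiskerEquivalence φ.orderIsoIio.equivalence
  refine ⟨(G.obj o).left, ε.hom.left ≫ (G.map (homOfLE bot_le)).left, (G.obj o).hom, ?_, ?_,
    by simp⟩
  · refine MorphismProperty.transfiniteCompositionsOfShape_le_transfiniteCompositions _ o.ToType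
      _ ⟨{ F := φ.monotone.functor ⋙ G ⋙ Over.forget B
           isoBot := (Over.forget B).mapIso (G.mapIso (eqToIso φ.map_bot) ≪≫ ε.symm)
           isWellOrderContinuous := hseq.continuous
           incl := (φ.cocone (G ⋙ Over.forget B)).ι
           isColimit := hc'
           fac := ?_
           map_mem := hseq.map_mem }⟩
    change (ε.hom ≫ G.map (eqToHom φ.map_bot.symm)).left ≫
      (G.map (homOfLE (φ.lt_top ⊥).le)).left = _
    rw [← Over.comp_left, Category.assoc, ← G.map_comp, ← Over.comp_left]
    rfl
  · intro P Q i hi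
    refine ⟨fun {u w} sq => ?_⟩
    have := hκ i hi o.ToType _ (by rwa [Ordinal.cof_toType]) hseq'
    obtain ⟨b, hb, u', hu⟩ : ∃ (b : Ordinal.{v}) (hb : b < o) (u' : P ⟶ (G.obj b).left),
        u' ≫ (G.map (homOfLE hb.le)).left = u := by
      obtain ⟨k, u', hu⟩ := Types.jointly_surjective_of_isColimit
        (isColimitOfPreserves (coyoneda.obj (Opposite.op P)) hc') u
      exact ⟨φ k, φ.lt_top k, u', hu⟩
    let p : LiftingProblem I (G.obj b) := ⟨⟨Arrow.mk i, hi⟩, ⟨(u', w), by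
      have := sq.w
      rwa [← hu, Category.assoc, Over.w] at this⟩⟩
    obtain ⟨t, ht, htw⟩ : ∃ t : Q ⟶ (G.obj (Order.succ (l b p))).left,
        (u' ≫ (G.map (homOfLE (hkl b p))).left) ≫
          (G.map (homOfLE (Order.le_succ (l b p)))).left = i ≫ t ∧ t ≫ (G.obj _).hom = w := by
      obtain ⟨t, ht, htw⟩ := hl b p
      exact ⟨t, ht.w, htw⟩
    have hlo : Order.succ (l b p) ≤ o :=
      (Ordinal.le_iSup (fun p => Order.succ (l b p)) p).trans (hclosed _ hb).le
    refine ⟨⟨⟨t ≫ (G.map (homOfLE hlo)).left, ?_, by rw [Category.assoc, Over.w, htw]⟩⟩⟩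
    rw [← Category.assoc, ← ht, ← hu]
    simp only [Category.assoc, ← Over.comp_left, ← G.map_comp]
    rfl

end SmallObjectArgument

/-! ### From lifting properties to Ext-orthogonality. -/

section CotorsionPairs

variable {C : Type u} [Category.{v} C]

lemma hasLiftingProperty_of_relativeCells {I : MorphismProperty C} {A X M N : C} {j : A ⟶ X}
    {p : M ⟶ N} (hj : relativeCells I j) (hp : I.rlp p) : HasLiftingProperty j p := by
  have h := MorphismProperty.transfiniteCompositions_le_llp_rlp _ _ hj
  rw [MorphismProperty.rlp_pushouts] at h
  exact h p hp

namespace ExactStructure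

variable [Preadditive C] [HasZeroObject C] (E : ExactStructure C)

/-- If the deflation of a conflation lies in `I`-inj and `T` is its kernel, then `T ⟶ 0` lies in
`I`-inj. -/
lemma rlp_to_zero_of_conflation {I : MorphismProperty C} {T M N : C} {i : T ⟶ M} {p : M ⟶ N}
    {w : i ≫ p = 0} (h : E.conflation (ShortComplex.mk i p w)) (hp : I.rlp p) :
    I.rlp (0 : T ⟶ (0 : C)) := by
  intro A B f hf
  refine ⟨fun {u v} sq => ?_⟩
  have := hp _ hf
  have := mono_of_conflation h
  have sq' : CommSq (u ≫ i) f p 0 := ⟨by simp [w]⟩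
  obtain ⟨l, hl⟩ := exists_lift_of_conflation h sq'.lift sq'.fac_right
  exact ⟨⟨⟨l, by rw [← cancel_mono i, Category.assoc, hl, sq'.fac_left],
    (isZero_zero C).eq_of_tgt _ _⟩⟩⟩

variable [HasBinaryBiproducts C]

/-- Deflations with kernel in `(Cok I)^⊥` have the right lifting property with respect
to `I`. -/
lemma rlp_of_conflation (hE : E.IsWeaklyIdempotentComplete) {I : MorphismProperty C}
    (hI : I ≤ E.inflation) {T M N : C} {i : T ⟶ M} {p : M ⟶ N} {w : i ≫ p = 0}
    (h : E.conflation (ShortComplex.mk i p w)) (hT : E.rightPerp (cokernelClass I) T) :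
    I.rlp p := by
  intro A B f hf
  obtain ⟨S, q, hq, hc⟩ := hI _ hf
  exact E.hasLiftingProperty_of_extVanishes hE hc h (hT S ⟨_, _, f, q, hq, hf, E.isCokernel _ hc⟩)

/-- The cokernel of a relative `I`-cell complex lies in `^⊥((Cok I)^⊥)`. -/
lemma leftPerp_of_relativeCells (hE : E.IsWeaklyIdempotentComplete) {I : MorphismProperty C}
    (hI : I ≤ E.inflation) {A X S : C} {j : A ⟶ X} {q : X ⟶ S} {w : j ≫ q = 0}
    (h : E.conflation (ShortComplex.mk j q w)) (hj : relativeCells I j) :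
    E.leftPerp (E.rightPerp (cokernelClass I)) S := by
  intro Y hY
  rw [extVanishes_iff]
  intro M i p w' hc
  have := hasLiftingProperty_of_relativeCells hj (E.rlp_of_conflation hE hI hc hY)
  -- A lift of `q` through `p` vanishing on `A` descends to a section of `p`.
  have sq : CommSq 0 j p q := ⟨by simp [w]⟩
  have := epi_of_conflation h
  obtain ⟨d, hd⟩ := exists_desc_of_conflation h sq.lift sq.fac_left
  exact ⟨d, by rw [← cancel_epi q, reassoc_of% hd, sq.fac_right, Category.comp_id]⟩

lemma leftPerp_of_cellObjects (hE : E.IsWeaklyIdempotentComplete) {I : MorphismProperty C}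
    (hI : I ≤ E.inflation) {B : C} (hB : cellObjects I B) :
    E.leftPerp (E.rightPerp (cokernelClass I)) B := by
  have : Mono (0 : (0 : C) ⟶ B) := ⟨fun _ _ _ => (isZero_zero C).eq_of_tgt _ _⟩
  exact E.leftPerp_of_relativeCells hE hI (w := zero_comp)
    (E.conflation_of_kernel _ (E.id_deflation B) fun t ht => ⟨0, by simpa using ht.symm⟩) hB

/-- If the `I`-cell complexes generate, then morphisms in `I`-inj are deflations. -/
lemma deflation_of_rlp (hE : E.IsWeaklyIdempotentComplete) {I : MorphismProperty C}
    (hgen : E.IsGeneratingClass (cellObjects I)) {B A : C} (p : B ⟶ A) (hp : I.rlp p) :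
    E.deflation p := by
  obtain ⟨S, G, c, g, hG, ⟨hc⟩, hg⟩ := hgen A
  have H : ∀ s, ∃ l : G s ⟶ B, l ≫ p = c.inj s ≫ g := fun s => by
    have := hasLiftingProperty_of_relativeCells (hG s) hp
    have sq : CommSq 0 (0 : (0 : C) ⟶ G s) p (c.inj s ≫ g) := ⟨by simp⟩
    exact ⟨sq.lift, sq.fac_right⟩
  choose l hl using H
  -- The generating deflation factors through `p`, since each `G s` is a cell complex and so lifts
  -- against `p`.
  refine E.deflation_of_comp hE (Cofan.IsColimit.desc hc l) p ?_
  convert hg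
  refine Cofan.IsColimit.hom_ext hc _ _ fun s => ?_
  rw [← hl s, ← Category.assoc, Cofan.IsColimit.fac]

/-- The extension pulled back along `r` splits, and restricting its section along `i` splits the
original. -/
lemma extVanishes_of_retract {A B Y : C} (i : A ⟶ B) (r : B ⟶ A) (hir : i ≫ r = 𝟙 A)
    (h : E.ExtVanishes B Y) : E.ExtVanishes A Y := by
  rw [extVanishes_iff] at h ⊢
  intro M j p w hc
  obtain ⟨W, p', r', hW, -⟩ := E.pullback_deflation p r ⟨_, _, _, hc⟩
  obtain ⟨j', w', -, hc'⟩ := E.exists_conflation_of_isPullback hc hW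
  obtain ⟨s, hs⟩ := h _ _ _ _ hc'
  exact ⟨i ≫ s ≫ r', by rw [Category.assoc, Category.assoc, hW.w, reassoc_of% hs, hir]⟩

end ExactStructure

end CotorsionPairs

end CategoryTheory

/-! ### The complete cotorsion pair generated by `I`. -/

theorem theorem3p7 {C : Type u} [Category.{v} C] [Preadditive C] [HasZeroObject C]
    [HasBinaryBiproducts C] (E : ExactStructure C) (hE : E.IsWeaklyIdempotentComplete)
    (I : MorphismProperty C) [MorphismProperty.IsSmall.{v} I] (hI : I ≤ E.inflation)
    (hhom : E.IsHomological I) (hsmall : AdmitsSmallObjectArgument I)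
    (hcell : relativeCells I ≤ E.inflation) (hgen : E.IsGeneratingClass (cellObjects I)) :
    (∀ A : C, ∃ (T B : C) (i : T ⟶ B) (p : B ⟶ A) (w : i ≫ p = 0),
      E.conflation (ShortComplex.mk i p w) ∧
        E.rightPerp (cokernelClass I) T ∧ cellObjects I B) ∧
    E.IsCompleteCotorsionPair (E.leftPerp (E.rightPerp (cokernelClass I)))
      (E.rightPerp (cokernelClass I)) ∧
    E.leftPerp (E.rightPerp (cokernelClass I)) = directSummands (cellObjects I) := by
  have hpo : ∀ {P Q P' : C} (i : P ⟶ Q) (f : P ⟶ P'), I i →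
      ∃ (Q' : C) (i' : P' ⟶ Q') (f' : Q ⟶ Q'), IsPushout f i i' f' := fun i f hi => by
    obtain ⟨Q', i', f', h, -⟩ := E.pushout_inflation i f (hI _ hi)
    exact ⟨Q', i', f', h⟩
  have ha : ∀ A : C, ∃ (T B : C) (i : T ⟶ B) (p : B ⟶ A) (w : i ≫ p = 0),
      E.conflation (ShortComplex.mk i p w) ∧
        E.rightPerp (cokernelClass I) T ∧ cellObjects I B := fun A => by
    obtain ⟨B, j, p, hj, hp, -⟩ := hsmall.exists_factorization hpo (0 : (0 : C) ⟶ A)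
    obtain ⟨T, i, w, hc⟩ := E.deflation_of_rlp hE hgen p hp
    obtain rfl : j = 0 := (isZero_zero C).eq_of_src _ _
    exact ⟨T, B, i, p, w, hc, hhom T (E.rlp_to_zero_of_conflation hc hp), hj⟩
  refine ⟨ha, ⟨⟨rfl, ?_⟩, fun A => ?_, fun A => ?_⟩, ?_⟩
  · ext Y
    exact ⟨fun hY X hX => hX Y hY, fun hY X hX => hY X fun Z hZ => hZ X hX⟩
  · obtain ⟨T, B, i, p, w, hc, hT, hB⟩ := ha A
    exact ⟨T, B, i, p, w, hc, E.leftPerp_of_cellObjects hE hI hB, hT⟩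
  · obtain ⟨Y, j, p, hj, hp, -⟩ := hsmall.exists_factorization hpo (0 : A ⟶ (0 : C))
    obtain ⟨X, q, w, hc⟩ := hcell _ hj
    obtain rfl : p = 0 := (isZero_zero C).eq_of_tgt _ _
    exact ⟨Y, X, j, q, w, hc, E.leftPerp_of_relativeCells hE hI hc hj, hhom Y hp⟩
  · ext A
    constructor
    · intro hA
      obtain ⟨T, B, i, p, w, hc, hT, hB⟩ := ha A
      obtain ⟨s, hs⟩ := (E.extVanishes_iff A T).1 (hA T hT) _ _ _ _ hc
      obtain ⟨r, hr₁, hr₂, hr₃⟩ := ExactStructure.exists_retraction_of_section hc s hs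
      exact ⟨B, T, hB, ⟨{ hom := biprod.lift p r
                          inv := biprod.desc s i
                          hom_inv_id := by rw [biprod.lift_desc, add_comm, hr₃]
                          inv_hom_id := by ext <;> simp [hs, hr₁, hr₂, w] }⟩⟩
    · rintro ⟨B, A', hB, ⟨e⟩⟩ Y hY
      exact E.extVanishes_of_retract (biprod.inl ≫ e.inv) (e.hom ≫ biprod.fst) (by simp)
        (E.leftPerp_of_cellObjects hE hI hB Y hY)
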